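/- Let $\Omega$ be a countably infinite set, let $\mathrm{Self}(\Omega)$ be the monoid (under composition) of all maps $\Omega\to\Omega$, and let $\mathrm{Sym}(\Omega)\subseteq\mathrm{Self}(\Omega)$ be the group of all permutations of $\Omega$. Equip $\mathrm{Self}(\Omega)$ with the function topology, i.e. the product topology on $\Omega^\Omega$ with $\Omega$ discrete (a subbasis of open sets is given by the sets $\{f : f(\alpha)=\beta\}$ with $\alpha,\beta\in\Omega$), and $\mathrm{Sym}(\Omega)$ with the subspace topology. For submonoids $M_1,M_2$ of $\mathrm{Self}(\Omega)$ write $M_1\preccurlyeq M_2$ if there is a finite set $U\subseteq\mathrm{Self}(\Omega)$ such that $M_1$ is contained in the submonoid $\langle M_2\cup U\rangle$ generated by $M_2\cup U$, and write $M_1\approx M_2$ if $M_1\preccurlyeq M_2$ and $M_2\preccurlyeq M_1$. Let $G$ be a subgroup of $\mathrm{Sym}(\Omega)$, let $\mathrm{cl}_S(G)$ be the closure of $G$ in $\mathrm{Sym}(\Omega)$, and let $\mathrm{cl}_E(G)$ be the closure of $G$ in $\mathrm{Self}(\Omega)$. Then $\mathrm{cl}_S(G)\approx\mathrm{cl}_E(G)$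 as submonoids of $\mathrm{Self}(\Omega)$. -/

import Mathlib

namespace SelfMap

/-- `M₁ ≼ M₂` for submonoids of a monoid `M`: there is a finite set `U ⊆ M` such that `M₁` is
contained in the submonoid generated by `M₂ ∪ U`. -/
def Preceq {M : Type*} [Monoid M] (M₁ M₂ : Submonoid M) : Prop :=
  ∃ U : Set M, U.Finite ∧ M₁ ≤ Submonoid.closure ((M₂ : Set M) ∪ U)

/-- `M₁ ≈ M₂` for submonoids of a monoid `M`: `M₁ ≼ M₂` and `M₂ ≼ M₁`. -/
def Approx {M : Type*} [Monoid M] (M₁ M₂ : Submonoid M) : Prop :=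
  Preceq M₁ M₂ ∧ Preceq M₂ M₁

/-- The function topology on `Self(Ω) = Function.End Ω`: the product topology on `Ω → Ω`,
where `Ω` is discrete. -/
instance functionTopology (Ω : Type*) : TopologicalSpace (Function.End Ω) :=
  @Pi.topologicalSpace Ω (fun _ => Ω) (fun _ => ⊥)

/-- The function topology is generated by the sets `{f | f α = β}`. -/
theorem functionTopology_eq_generateFrom (Ω : Type*) :
    functionTopology Ω =
      TopologicalSpace.generateFrom {s | ∃ α β : Ω, s = {f : Function.End Ω | f α = β}} := by
  apply le_antisymm
  · refine le_generateFrom ?_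
    rintro _ ⟨α, β, rfl⟩
    let _ : TopologicalSpace Ω := ⊥
    have : DiscreteTopology Ω := ⟨rfl⟩
    exact (isOpen_discrete ({β} : Set Ω)).preimage (continuous_apply (A := fun _ : Ω => Ω) α)
  · refine le_iInf fun α => ?_
    let _ : TopologicalSpace Ω := ⊥
    have : DiscreteTopology Ω := ⟨rfl⟩
    let t : TopologicalSpace (Ω → Ω) :=
      TopologicalSpace.generateFrom {s | ∃ α β : Ω, s = {f : Ω → Ω | f α = β}}
    have h : Continuous (fun f : Ω → Ω => f α) := continuous_discrete_rng.2 fun β =>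
      TopologicalSpace.isOpen_generateFrom_of_mem ⟨α, β, rfl⟩
    exact continuous_iff_le_induced.1 h

/-- Composition of self-maps is jointly continuous. -/
instance continuousMulEnd (Ω : Type*) : ContinuousMul (Function.End Ω) := by
  constructor
  let _ : TopologicalSpace Ω := ⊥
  have : DiscreteTopology Ω := ⟨rfl⟩
  refine continuous_pi (A := fun _ : Ω => Ω) fun a => ?_
  refine continuous_discrete_rng.2 fun b => ?_
  have h : (fun p : Function.End Ω × Function.End Ω => (p.1 * p.2) a) ⁻¹' {b} =
      ⋃ c : Ω, {f : Function.End Ω | f c = b} ×ˢ {g : Function.End Ω | g a = c} := by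
    ext p
    simp [Function.End.mul_def, Function.comp_apply (f := p.1) (g := p.2)]
  rw [h]
  refine isOpen_iUnion fun c => IsOpen.prod ?_ ?_
  · exact (isOpen_discrete ({b} : Set Ω)).preimage (continuous_apply (A := fun _ : Ω => Ω) c)
  · exact (isOpen_discrete ({c} : Set Ω)).preimage (continuous_apply (A := fun _ : Ω => Ω) a)

/-- The inclusion `Sym(Ω) ⊆ Self(Ω)`. -/
def permToEnd (Ω : Type*) : Equiv.Perm Ω →* Function.End Ω where
  toFun σ := fun a => σ a
  map_one' := rfl
  map_mul' _ _ := rfl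

/-- The function topology on `Sym(Ω)`: the subspace topology inherited from `Self(Ω)`. -/
instance permTopology (Ω : Type*) : TopologicalSpace (Equiv.Perm Ω) :=
  TopologicalSpace.induced (permToEnd Ω) (functionTopology Ω)

instance continuousMulPerm (Ω : Type*) : ContinuousMul (Equiv.Perm Ω) :=
  continuousMul_induced (permToEnd Ω)

/-- The closure of the group `G` in `Sym(Ω)`, regarded as a submonoid of `Self(Ω)`. -/
def closureSym {Ω : Type*} (G : Subgroup (Equiv.Perm Ω)) : Submonoid (Function.End Ω) :=
  G.toSubmonoid.topologicalClosure.map (permToEnd Ω)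

/-- The closure of the group `G` in `Self(Ω)`. -/
def closureSelf {Ω : Type*} (G : Subgroup (Equiv.Perm Ω)) : Submonoid (Function.End Ω) :=
  (G.toSubmonoid.map (permToEnd Ω)).topologicalClosure

/-- The closure in `Sym(Ω)` is the intersection of the closure in `Self(Ω)` with `Sym(Ω)`. -/
theorem closureSym_eq {Ω : Type*} (G : Subgroup (Equiv.Perm Ω)) :
    closureSym G = closureSelf G ⊓ MonoidHom.mrange (permToEnd Ω) := by
  have key : ∀ σ : Equiv.Perm Ω, σ ∈ closure (G : Set (Equiv.Perm Ω)) ↔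
      permToEnd Ω σ ∈ closure (permToEnd Ω '' (G : Set (Equiv.Perm Ω))) :=
    fun σ => closure_induced (f := permToEnd Ω)
  ext f
  constructor
  · rintro ⟨σ, hσ, rfl⟩
    exact ⟨(key σ).1 hσ, σ, rfl⟩
  · rintro ⟨hf, σ, rfl⟩
    exact ⟨σ, (key σ).2 hf, rfl⟩

end SelfMap

/-!
Write `H` and `E` for the closures of `G` in `Sym(Ω)` and in `Self(Ω)`. Since `H ≤ E`, the content
is that `E` lies in the submonoid generated by `H` and finitely many maps. There are two cases.

If some finite `X` has a pointwise stabilizer in `H` with finite orbits only, then every element of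
`E` is already a permutation (`closureSelf_le_closureSym`), so `E = H`.

Otherwise the pointwise stabilizer of every finite set has an infinite orbit, and `H` generates
all of `Self(Ω)` together with finitely many maps (`exists_finite_closure_eq_top`, for `Ω = ℕ`).
This rests on two families of elements of `H`, both obtained as infinite products
(`IsLimitClosed.exists_limit`).
* The limits along a finitely branching tree, combined with two fixed maps, give every
  self-map bounded by a prescribed function `R` (`exists_factor_of_bounded`).
* A finitely branching tree gives a compact, hence never a dominating, family. Elements growing
  faster than any given `f` come from `exists_dominating`: by P. M. Neumann's lemma, an element of
  a stabilizer can move arbitrarily many points of an infinite orbit arbitrarily far. Such an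
  element also moves the preimages of points that are to be controlled later, so it
  can be followed by a long gap in which nothing more is moved. The length of
  this gap is bounded by a fixed function `ψ` of the distance to which the points were moved, so
  one application of the element and of `ψ` carries every point beyond the gap, and a second
  application of the element carries it beyond the values of `f`. All of this can be done
  injectively (`exists_injective_factor_ge`).

Finally, if `J` is injective and `f ≤ J`, then `f = q ∘ J` for a map `q` with `q n ≤ n`, so that
every `f` is obtained.
-/

namespace SelfMap

open scoped Pointwise

/-! ### Pointwise stabilizers, separation and limits -/

/-- The pointwise stabilizer of `X` in the permutation group `H`. -/
def fixer {Ω : Type*} (H : Subgroup (Equiv.Perm Ω)) (X : Set Ω) : Subgroup (Equiv.Perm Ω) :=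
  H ⊓ fixingSubgroup (Equiv.Perm Ω) X

theorem mem_fixer {Ω : Type*} {H : Subgroup (Equiv.Perm Ω)} {X : Set Ω} {h : Equiv.Perm Ω} :
    h ∈ fixer H X ↔ h ∈ H ∧ ∀ x ∈ X, h x = x := by
  simp [fixer, Subgroup.mem_inf, mem_fixingSubgroup_iff]

theorem mem_orbit_fixer {Ω : Type*} {H : Subgroup (Equiv.Perm Ω)} {X : Set Ω} {x y : Ω} :
    y ∈ MulAction.orbit (fixer H X) x ↔ ∃ h ∈ fixer H X, h x = y := by
  constructor
  · rintro ⟨h, rfl⟩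
    exact ⟨h, h.2, rfl⟩
  · rintro ⟨h, hh, rfl⟩
    exact ⟨⟨h, hh⟩, rfl⟩

/-- P. M. Neumann's separation lemma, a consequence of B. H. Neumann's lemma: the elements that
move some `x ∈ F` into `F'` form finitely many cosets of point stabilizers, all of infinite
index. -/
theorem exists_smul_notMem_of_infinite_orbit {K Ω : Type*} [Group K] [MulAction K Ω]
    (F F' : Finset Ω) (hF : ∀ x ∈ F, (MulAction.orbit K x).Infinite) :
    ∃ g : K, ∀ x ∈ F, g • x ∉ F' := by
  classical
  by_contra! hcon
  have hch : ∀ p : Ω × Ω, ∃ g : K, (∃ h : K, h • p.1 = p.2) → g • p.1 = p.2 := fun p => by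
    by_cases h : ∃ h : K, h • p.1 = p.2
    · exact ⟨h.choose, fun _ => h.choose_spec⟩
    · exact ⟨1, fun h' => absurd h' h⟩
  choose c hc using hch
  have hcov : ⋃ p ∈ F ×ˢ F', c p • (MulAction.stabilizer K p.1 : Set K) = Set.univ := by
    refine Set.eq_univ_of_forall fun g => ?_
    obtain ⟨x, hx, hgx⟩ := hcon g
    refine Set.mem_biUnion (x := (x, g • x)) (Finset.mem_coe.2 (Finset.mk_mem_product hx hgx)) ?_
    rw [mem_leftCoset_iff, SetLike.mem_coe, MulAction.mem_stabilizer_iff, mul_smul,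
      inv_smul_eq_iff]
    exact (hc (x, g • x) ⟨g, rfl⟩).symm
  obtain ⟨p, hp, hfin⟩ := Subgroup.exists_finiteIndex_of_leftCoset_cover hcov
  have : Finite (K ⧸ MulAction.stabilizer K p.1) := Subgroup.finite_quotient_of_finiteIndex
  have : Finite (MulAction.orbit K p.1) :=
    Finite.of_equiv _ (MulAction.orbitEquivQuotientStabilizer K p.1).symm
  exact hF p.1 (Finset.mem_product.1 hp).1 (Set.toFinite _)

/-- A system of distinct representatives exists when the `n`-th set has more than `n` elements. -/
theorem exists_injective_mem_of_lt_card {α : Type*} (C : ℕ → Finset α) (hC : ∀ n, n < (C n).card) :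
    ∃ c : ℕ → α, Function.Injective c ∧ ∀ n, c n ∈ C n := by
  classical
  refine (Finset.all_card_le_biUnion_card_iff_exists_injective C).1 fun s => ?_
  rcases s.eq_empty_or_nonempty with rfl | hs
  · simp
  · have h1 : s ⊆ Finset.range (s.max' hs + 1) := fun i hi =>
      Finset.mem_range.2 (Nat.lt_succ_of_le (s.le_max' i hi))
    calc s.card ≤ s.max' hs + 1 := by simpa using Finset.card_le_card h1
      _ ≤ (C (s.max' hs)).card := hC _
      _ ≤ _ := Finset.card_le_card (Finset.subset_biUnion_of_mem C (s.max'_mem hs))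

/-- Countably many infinite sets of naturals admit a colouring for which each of them contains
every colour. -/
theorem exists_coloring_surjOn {ι : Type*} [Countable ι] (S : ι → Set ℕ)
    (hS : ∀ i, (S i).Infinite) : ∃ b : ℕ → ℕ, ∀ i m, ∃ y ∈ S i, b y = m := by
  rcases isEmpty_or_nonempty ι with hι | hι
  · exact ⟨id, fun i => isEmptyElim i⟩
  obtain ⟨e, he⟩ := exists_surjective_nat ι
  obtain ⟨φ, hφ, hφS⟩ := Filter.extraction_forall_of_frequently
    (P := fun t y => y ∈ S (e t.unpair.1))
    fun t => Nat.frequently_atTop_iff_infinite.2 (hS (e t.unpair.1))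
  refine ⟨fun y => (Function.invFun φ y).unpair.2, fun i m => ?_⟩
  obtain ⟨k, rfl⟩ := he i
  refine ⟨φ (Nat.pair k m), by simpa using hφS (Nat.pair k m), ?_⟩
  simp [Function.leftInverse_invFun hφ.injective (Nat.pair k m)]

/-- `H` contains every permutation that agrees with members of `H` on all finite sets, i.e. `H` is
closed in the function topology. -/
def IsLimitClosed {Ω : Type*} (H : Subgroup (Equiv.Perm Ω)) : Prop :=
  ∀ p : Equiv.Perm Ω, (∀ X : Finset Ω, ∃ h ∈ H, ∀ x ∈ X, h x = p x) → p ∈ H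

/-- An infinite product `h₀ h₁ h₂ ⋯` with partial products `g j` converges in a closed group `H`
when `h j` fixes `Γ j`, and `Γ j` contains the first `j` points and their preimages
under `g j`. The condition on preimages makes the limit surjective. -/
theorem IsLimitClosed.exists_limit {H : Subgroup (Equiv.Perm ℕ)} (hc : IsLimitClosed H)
    (g : ℕ → Equiv.Perm ℕ) (Γ : ℕ → Set ℕ) (hg0 : g 0 = 1) (hΓ : Monotone Γ)
    (hg : ∀ j, ∃ h ∈ fixer H (Γ j), g (j + 1) = g j * h)
    (hmem : ∀ j, ∀ l < j, l ∈ Γ j) (hinv : ∀ j, ∀ l < j, (g j)⁻¹ l ∈ Γ j) :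
    ∃ p ∈ H, ∀ j, ∀ x ∈ Γ j, p x = g j x := by
  have hgH : ∀ j, g j ∈ H := fun j => by
    induction j with
    | zero => exact hg0 ▸ H.one_mem
    | succ j ih =>
      obtain ⟨h, hh, e⟩ := hg j
      exact e ▸ H.mul_mem ih (mem_fixer.1 hh).1
  have hstab : ∀ j i, j ≤ i → ∀ x ∈ Γ j, g i x = g j x := fun j i hji x hx => by
    induction i, hji using Nat.le_induction with
    | base => rfl
    | succ i hi ih =>
      obtain ⟨h, hh, e⟩ := hg i
      rw [e, Equiv.Perm.mul_apply, (mem_fixer.1 hh).2 x (hΓ hi hx), ih]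
  have hlim : ∀ x i, x + 1 ≤ i → g i x = g (x + 1) x := fun x i hi =>
    hstab _ _ hi x (hmem _ _ (Nat.lt_succ_self x))
  have hpre : ∀ l i, l + 1 ≤ i → g i ((g (l + 1))⁻¹ l) = l := fun l i hi => by
    rw [hstab _ _ hi _ (hinv _ _ (Nat.lt_succ_self l))]
    simp
  let p : Equiv.Perm ℕ :=
    { toFun := fun x => g (x + 1) x
      invFun := fun l => (g (l + 1))⁻¹ l
      left_inv := fun x => by
        have h1 := hpre (g (x + 1) x) (max (x + 1) (g (x + 1) x + 1)) (le_max_right _ _)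
        have h2 := hlim x _ (le_max_left (x + 1) (g (x + 1) x + 1))
        exact (g _).injective (h1.trans h2.symm)
      right_inv := fun l => by
        have h1 := hpre l (max (l + 1) ((g (l + 1))⁻¹ l + 1)) (le_max_left _ _)
        rwa [hlim _ _ (le_max_right _ _)] at h1 }
  have hp : ∀ j, ∀ x ∈ Γ j, p x = g j x := fun j x hx => by
    rw [← hstab j (max j (x + 1)) (le_max_left _ _) x hx]
    exact (hlim x _ (le_max_right _ _)).symm
  refine ⟨p, hc p fun X => ⟨g (X.sup id + 1), hgH _, fun x hx => ?_⟩, hp⟩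
  exact (hp _ x (hmem _ _ (Nat.lt_succ_of_le (Finset.le_sup (f := id) hx)))).symm

/-! ### Two families of elements of a closed group -/

/-- There are only countably many orbits of pointwise stabilizers of finite sets, and a translate
`g '' O` of such an orbit is again one. Hence one colouring serves all these sets. -/
theorem exists_coloring_orbit_fixer (H : Subgroup (Equiv.Perm ℕ)) :
    ∃ b : ℕ → ℕ, ∀ (X : Finset ℕ) (α : ℕ), (MulAction.orbit (fixer H X) α).Infinite →
      ∀ g ∈ H, ∀ m, ∃ h ∈ fixer H X, b (g (h α)) = m := by
  obtain ⟨b, hb⟩ := exists_coloring_surjOn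
    (ι := {q : Finset ℕ × ℕ // (MulAction.orbit (fixer H q.1) q.2).Infinite})
    (fun q => MulAction.orbit (fixer H q.1.1) q.1.2) fun q => q.2
  refine ⟨b, fun X α hX g hg m => ?_⟩
  have hinf : (MulAction.orbit (fixer H (X.image g : Finset ℕ)) (g α)).Infinite := by
    refine (hX.image g.injective.injOn).mono ?_
    rintro _ ⟨y, hy, rfl⟩
    obtain ⟨h, hh, rfl⟩ := mem_orbit_fixer.1 hy
    refine mem_orbit_fixer.2 ⟨g * h * g⁻¹, mem_fixer.2 ⟨?_, ?_⟩, by simp⟩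
    · exact H.mul_mem (H.mul_mem hg (mem_fixer.1 hh).1) (H.inv_mem hg)
    · intro x hx
      obtain ⟨x, hxX, rfl⟩ := Finset.mem_image.1 (Finset.mem_coe.1 hx)
      simp [(mem_fixer.1 hh).2 x (Finset.mem_coe.2 hxX)]
  obtain ⟨y, hy, rfl⟩ := hb ⟨(X.image g, g α), hinf⟩ m
  obtain ⟨k, hk, rfl⟩ := mem_orbit_fixer.1 hy
  refine ⟨g⁻¹ * k * g, mem_fixer.2 ⟨?_, fun x hx => ?_⟩, by simp⟩
  · exact H.mul_mem (H.mul_mem (H.inv_mem hg) (mem_fixer.1 hk).1) hg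
  · have := (mem_fixer.1 hk).2 (g x) (Finset.mem_coe.2 (Finset.mem_image_of_mem g hx))
    simp [this]

variable {H : Subgroup (Equiv.Perm ℕ)}

/-- Every function bounded by `R` has the form `b ∘ g ∘ a` with `g ∈ H` and fixed `a`, `b`.
The elements `g` are the limits along the branches of a tree in `H` whose `n`-th level branches
into `R n + 1` choices for the colour of `g (a n)`. All levels being finite, the
points to be fixed from level `n` on form a finite set, so that `a n` can depend on `n` alone. -/
theorem exists_factor_of_bounded (hc : IsLimitClosed H)
    (hinf : ∀ X : Finset ℕ, ∃ α : ℕ, (MulAction.orbit (fixer H X) α).Infinite) (R : ℕ → ℕ) :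
    ∃ a b : ℕ → ℕ, ∀ r : ℕ → ℕ, (∀ n, r n ≤ R n) → ∃ g ∈ H, ∀ n, b (g (a n)) = r n := by
  classical
  choose pt hpt using hinf
  obtain ⟨b, hb⟩ := exists_coloring_orbit_fixer H
  have hstep : ∀ (X : Finset ℕ) (g : Equiv.Perm ℕ) (m : ℕ), ∃ h : Equiv.Perm ℕ,
      g ∈ H → h ∈ fixer H X ∧ b (g (h (pt X))) = m := fun X g m => by
    by_cases hg : g ∈ H
    · obtain ⟨h, h1, h2⟩ := hb X _ (hpt X) g hg m
      exact ⟨h, fun _ => ⟨h1, h2⟩⟩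
    · exact ⟨1, fun h => absurd h hg⟩
  choose ext hext using hstep
  -- The elements on level `n + 1` of the tree, from the fixed set and the elements on level `n`.
  let next (n : ℕ) (T : Finset ℕ × Finset (Equiv.Perm ℕ)) : Finset (Equiv.Perm ℕ) :=
    (T.2 ×ˢ Finset.range (R n + 1)).image fun q => q.1 * ext T.1 q.1 q.2
  let tree : ℕ → Finset ℕ × Finset (Equiv.Perm ℕ) := fun n => Nat.rec (∅, {1}) (fun n T =>
    (T.1 ∪ {pt T.1} ∪ Finset.range (n + 1) ∪
      (next n T ×ˢ Finset.range (n + 1)).image (fun q => q.1⁻¹ q.2), next n T)) n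
  let Γ : ℕ → Finset ℕ := fun n => (tree n).1
  have hΓ : ∀ n, Γ (n + 1) = Γ n ∪ {pt (Γ n)} ∪ Finset.range (n + 1) ∪
      ((tree (n + 1)).2 ×ˢ Finset.range (n + 1)).image (fun q => q.1⁻¹ q.2) := fun n => rfl
  have htree : ∀ n, (tree (n + 1)).2 = ((tree n).2 ×ˢ Finset.range (R n + 1)).image
      fun q => q.1 * ext (Γ n) q.1 q.2 := fun n => rfl
  refine ⟨fun n => pt (Γ n), b, fun r hr => ?_⟩
  let g : ℕ → Equiv.Perm ℕ := fun n => Nat.rec 1 (fun n g => g * ext (Γ n) g (r n)) n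
  have hg : ∀ n, g (n + 1) = g n * ext (Γ n) (g n) (r n) := fun n => rfl
  have hgH : ∀ n, g n ∈ H := fun n => by
    induction n with
    | zero => exact H.one_mem
    | succ n ih =>
      rw [hg]
      exact H.mul_mem ih (mem_fixer.1 (hext (Γ n) _ (r n) ih).1).1
  have hgtree : ∀ n, g n ∈ (tree n).2 := fun n => by
    induction n with
    | zero => exact Finset.mem_singleton_self _
    | succ n ih =>
      rw [htree]
      exact Finset.mem_image.2 ⟨(g n, r n), Finset.mk_mem_product ih
        (Finset.mem_range.2 (Nat.lt_succ_of_le (hr n))), rfl⟩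
  obtain ⟨p, hp, hpg⟩ := hc.exists_limit g (fun n => (Γ n : Set ℕ)) rfl
    (monotone_nat_of_le_succ fun n x hx => by
      simp only [hΓ, Finset.mem_coe, Finset.mem_union]
      exact Or.inl (Or.inl (Or.inl hx)))
    (fun n => ⟨_, (hext (Γ n) _ (r n) (hgH n)).1, rfl⟩)
    (fun n l hl => by
      cases n with
      | zero => omega
      | succ n =>
        simp only [hΓ, Finset.mem_coe, Finset.mem_union]
        exact Or.inl (Or.inr (Finset.mem_range.2 hl)))
    (fun n l hl => by
      cases n with
      | zero => omega
      | succ n =>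
        simp only [hΓ, Finset.mem_coe, Finset.mem_union]
        exact Or.inr (Finset.mem_image.2 ⟨(g (n + 1), l),
          Finset.mk_mem_product (hgtree (n + 1)) (Finset.mem_range.2 hl), rfl⟩))
  refine ⟨p, hp, fun n => ?_⟩
  rw [hpg (n + 1) (pt (Γ n)) (by simp [hΓ]), hg]
  exact (hext (Γ n) _ (r n) (hgH n)).2

/-- `H` contains elements `g` that grow faster than any prescribed `f`, on a sequence of finite
blocks: `g` moves the first `N j` members of the infinite set enumerated by `o (k j)` out of
`[0, N j)`. The gaps between the blocks can depend on `f`, but they are controlled by `N` through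
the fixed function `ψ`. Only countably many partial products, one for each list of the
`N j` chosen so far, occur in the construction, and `ψ N` is the largest of the bounds needed for
the finitely many lists of code at most `N`. -/
theorem exists_dominating (hc : IsLimitClosed H)
    (hinf : ∀ X : Finset ℕ, ∃ α : ℕ, (MulAction.orbit (fixer H X) α).Infinite) :
    ∃ (o : ℕ → ℕ → ℕ) (ψ : ℕ → ℕ), (∀ k, Function.Injective (o k)) ∧ StrictMono ψ ∧
      ∀ f : ℕ → ℕ, ∃ g ∈ H, ∃ k N : ℕ → ℕ, StrictMono k ∧ k 0 = 0 ∧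
        ∀ j, k j ≤ N j ∧ f (k j) ≤ N j ∧ k (j + 1) ≤ ψ (N j) ∧
          ∀ i < N j, N j ≤ g (o (k j) i) := by
  classical
  choose pt hpt using fun k => hinf (Finset.range k)
  let o : ℕ → ℕ → ℕ := fun k i => (hpt k).natEmbedding _ i
  have ho : ∀ k i, o k i ∈ MulAction.orbit (fixer H (Finset.range k)) (pt k) :=
    fun k i => ((hpt k).natEmbedding _ i).2
  have hoinj : ∀ k, Function.Injective (o k) := fun k =>
    Subtype.val_injective.comp ((hpt k).natEmbedding _).injective
  have hstep : ∀ (g : Equiv.Perm ℕ) (k N : ℕ), ∃ h ∈ fixer H (Finset.range k),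
      ∀ i < N, N ≤ g (h (o k i)) := fun g k N => by
    obtain ⟨h, hh⟩ := exists_smul_notMem_of_infinite_orbit (K := fixer H (Finset.range k))
      ((Finset.range N).image (o k)) ((Finset.range N).image g.symm) (by
        intro x hx
        obtain ⟨i, -, rfl⟩ := Finset.mem_image.1 hx
        rw [MulAction.orbit_eq_iff.2 (ho k i)]
        exact hpt k)
    refine ⟨h, h.2, fun i hi => ?_⟩
    by_contra! hlt
    exact hh (o k i) (Finset.mem_image_of_mem _ (Finset.mem_range.2 hi))
      (Finset.mem_image.2 ⟨_, Finset.mem_range.2 hlt, g.symm_apply_apply _⟩)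
  choose mv hmv hmv' using hstep
  -- The partial product and the length of the interval fixed from then on, for the list of the
  -- parameters chosen so far (latest first).
  let st : List ℕ → Equiv.Perm ℕ × ℕ := fun L => List.rec (1, 0) (fun N L s =>
    (s.1 * mv s.1 s.2 N, s.2 + 1 + (Finset.range N).sup (fun i => o s.2 i + 1) +
      (Finset.range (L.length + 1)).sup (fun l => (s.1 * mv s.1 s.2 N)⁻¹ l + 1))) L
  have hst1 : ∀ N L, (st (N :: L)).1 = (st L).1 * mv (st L).1 (st L).2 N := fun N L => rfl
  have hst2 : ∀ N L, (st (N :: L)).2 = (st L).2 + 1 +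
      (Finset.range N).sup (fun i => o (st L).2 i + 1) +
      (Finset.range (L.length + 1)).sup (fun l => (st (N :: L)).1⁻¹ l + 1) := fun N L => rfl
  have hfin : ∀ c : ℕ, {L : List ℕ | Encodable.encode L ≤ c}.Finite := fun c =>
    (Set.finite_Iic c).preimage Encodable.encode_injective.injOn
  let ψ₀ : ℕ → ℕ := fun N => (hfin N).toFinset.sup fun L => (st (N :: L)).2
  let ψ : ℕ → ℕ := fun N => ∑ i ∈ Finset.range (N + 1), (ψ₀ i + 1)
  have hψ : StrictMono ψ := strictMono_nat_of_lt_succ fun N => by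
    simp only [ψ]
    rw [Finset.sum_range_succ _ (N + 1)]
    omega
  have hψ₀ : ∀ N, ψ₀ N ≤ ψ N := fun N => by
    simp only [ψ]
    rw [Finset.sum_range_succ]
    omega
  refine ⟨o, ψ, hoinj, hψ, fun f => ?_⟩
  let nx : List ℕ → ℕ := fun L => max (Encodable.encode L) (max (f (st L).2) (st L).2)
  let L : ℕ → List ℕ := fun j => Nat.rec [] (fun _ L => nx L :: L) j
  have hL : ∀ j, L (j + 1) = nx (L j) :: L j := fun j => rfl
  have hlen : ∀ j, (L j).length = j := fun j => by
    induction j with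
    | zero => rfl
    | succ j ih => rw [hL, List.length_cons, ih]
  have hk : ∀ j, (st (L (j + 1))).2 = (st (L j)).2 + 1 +
      (Finset.range (nx (L j))).sup (fun i => o (st (L j)).2 i + 1) +
      (Finset.range (j + 1)).sup (fun l => (st (L (j + 1))).1⁻¹ l + 1) := fun j => by
    conv_lhs => rw [hL, hst2, hlen]
  have hkmono : StrictMono fun j => (st (L j)).2 := strictMono_nat_of_lt_succ fun j => by
    simp only [hk]
    omega
  obtain ⟨p, hp, hpg⟩ := hc.exists_limit (fun j => (st (L j)).1)
    (fun j => (Finset.range (st (L j)).2 : Set ℕ)) rfl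
    (fun i j hij => by simpa using hkmono.monotone hij)
    (fun j => ⟨_, hmv (st (L j)).1 _ (nx (L j)), by simp only [hL, hst1]⟩)
    (fun j l hl => by simpa using hl.trans_le (hkmono.le_apply (x := j)))
    (fun j l hl => by
      cases j with
      | zero => omega
      | succ j =>
        have h1 := Finset.le_sup (f := fun l => (st (L (j + 1))).1⁻¹ l + 1) (Finset.mem_range.2 hl)
        have h2 := hk j
        simp only [Finset.coe_range, Set.mem_Iio]
        omega)
  refine ⟨p, hp, fun j => (st (L j)).2, fun j => nx (L j), hkmono, rfl, fun j =>
    ⟨?_, ?_, ?_, fun i hi => ?_⟩⟩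
  · exact (le_max_right _ _).trans (le_max_right _ _)
  · exact (le_max_left _ _).trans (le_max_right _ _)
  · have h1 : Encodable.encode (L j) ≤ nx (L j) := le_max_left _ _
    exact (Finset.le_sup (f := fun L' => (st (nx (L j) :: L')).2)
      ((hfin _).mem_toFinset.2 h1)).trans (hψ₀ _)
  · have h1 := Finset.le_sup (f := fun i => o (st (L j)).2 i + 1) (Finset.mem_range.2 hi)
    rw [hpg (j + 1) _ (by
      simp only [Finset.coe_range, Set.mem_Iio]
      have h2 := hk j
      simp only at h1
      omega)]
    exact hmv' _ _ _ i hi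

/-! ### Generating all self-maps -/

theorem _root_.StrictMono.exists_le_lt_succ {k : ℕ → ℕ} (hk : StrictMono k) (h0 : k 0 = 0)
    (n : ℕ) : ∃ j, k j ≤ n ∧ n < k (j + 1) := by
  induction n with
  | zero => exact ⟨0, h0.le, by simpa [h0] using hk Nat.zero_lt_one⟩
  | succ n ih =>
    obtain ⟨j, h1, h2⟩ := ih
    rcases (Nat.succ_le_of_lt h2).lt_or_eq with h | h
    · exact ⟨j, by omega, h⟩
    · exact ⟨j + 1, h.ge, h.trans_lt (hk (Nat.lt_succ_self _))⟩

/-- In the situation of `exists_dominating`, every `f` is bounded by an injective map which is a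
product of a fixed number of factors: fixed maps, elements of `H`, and maps bounded by a fixed `R`.
A point `n` of the `j`-th interval `[k j, k (j + 1))` is first sent beyond the end of that
interval by `ψ ∘ g ∘ r`. From there the block enumerated by `o (k (j + 1))` is reached by a bounded
map `p`, and `g` moves it beyond `f n`. -/
theorem exists_injective_factor_ge (hc : IsLimitClosed H)
    (hinf : ∀ X : Finset ℕ, ∃ α : ℕ, (MulAction.orbit (fixer H X) α).Infinite) :
    ∃ R ψ : ℕ → ℕ, (∀ n, n ≤ R n) ∧ ∀ f : ℕ → ℕ, ∃ g ∈ H, ∃ r p : ℕ → ℕ,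
      (∀ n, r n ≤ R n) ∧ (∀ n, p n ≤ R n) ∧
      Function.Injective (fun n => g (p (ψ (g (r n))))) ∧ ∀ n, f n ≤ g (p (ψ (g (r n)))) := by
  classical
  obtain ⟨o, ψ, ho, hψ, hdom⟩ := exists_dominating hc hinf
  let R : ℕ → ℕ := fun n => 2 * n +
    (Finset.range (n + 1)).sup fun k => (Finset.range (n + 1)).sup (o k)
  have hR : ∀ n k i, k ≤ n → i ≤ n → o k i ≤ R n := fun n k i hk hi => by
    have h1 := Finset.le_sup (f := o k) (Finset.mem_range.2 (Nat.lt_succ_of_le hi))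
    have h2 := Finset.le_sup (f := fun k => (Finset.range (n + 1)).sup (o k))
      (Finset.mem_range.2 (Nat.lt_succ_of_le hk))
    exact (h1.trans h2).trans (Nat.le_add_left _ _)
  have hR2 : ∀ n, 2 * n ≤ R n := fun n => Nat.le_add_right _ _
  refine ⟨R, ψ, fun n => by linarith [hR2 n], fun f => ?_⟩
  -- A monotone bound of `f`, so that its value at the end of an interval bounds `f` there.
  obtain ⟨g, hg, k, N, hk, hk0, hkN⟩ := hdom fun n => (Finset.range (n + 1)).sup f
  have hfle : ∀ n m, n ≤ m → f n ≤ (Finset.range (m + 1)).sup f := fun n m h =>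
    Finset.le_sup (Finset.mem_range.2 (Nat.lt_succ_of_le h))
  choose j hj1 hj2 using hk.exists_le_lt_succ hk0
  have hcardo : ∀ n q, ((Finset.range (n + 1)).image (o q)).card = n + 1 := fun n q => by
    rw [Finset.card_image_of_injective _ (ho q), Finset.card_range]
  -- Either the moved block has more than `n` members among its first `N (j n)` ones, or `N (j n)`
  -- is at most `n` and more than `n` points of `[0, 2 n]` have an image outside `[0, N (j n))`.
  obtain ⟨r, hrinj, hr⟩ := exists_injective_mem_of_lt_card
    (fun n => (Finset.range (R n + 1)).filter fun c => N (j n) ≤ g c) fun n => by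
      rcases lt_or_ge n (N (j n)) with h | h
      · refine (Nat.lt_succ_self n).trans_le ((hcardo n (k (j n))).ge.trans
          (Finset.card_le_card fun c hc => ?_))
        obtain ⟨i, hi, rfl⟩ := Finset.mem_image.1 hc
        have hin : i ≤ n := Nat.le_of_lt_succ (Finset.mem_range.1 hi)
        exact Finset.mem_filter.2 ⟨Finset.mem_range.2 (Nat.lt_succ_of_le (hR n _ _ (hj1 n) hin)),
          (hkN (j n)).2.2.2 i (hin.trans_lt h)⟩
      · have h1 : (Finset.range (2 * n + 1)) ⊆
            ((Finset.range (R n + 1)).filter fun c => N (j n) ≤ g c) ∪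
              (Finset.range (N (j n))).image g.symm := fun c hc => by
          rcases le_or_gt (N (j n)) (g c) with h' | h'
          · refine Finset.mem_union_left _ (Finset.mem_filter.2 ⟨Finset.mem_range.2 ?_, h'⟩)
            have := Finset.mem_range.1 hc
            have := hR2 n
            omega
          · exact Finset.mem_union_right _ (Finset.mem_image.2
              ⟨g c, Finset.mem_range.2 h', g.symm_apply_apply c⟩)
        have h2 := (Finset.card_le_card h1).trans (Finset.card_union_le _ _)
        rw [Finset.card_image_of_injective _ g.symm.injective, Finset.card_range,
          Finset.card_range] at h2
        omega
  have hminj : Function.Injective fun n => ψ (g (r n)) :=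
    hψ.injective.comp (g.injective.comp hrinj)
  have hm : ∀ n, k (j n + 1) ≤ ψ (g (r n)) := fun n =>
    (hkN (j n)).2.2.1.trans (hψ.monotone (Finset.mem_filter.1 (hr n)).2)
  obtain ⟨c, hcinj, hcmem⟩ := exists_injective_mem_of_lt_card
    (fun n => (Finset.range (n + 1)).image (o (k (j n + 1)))) fun n => by
      rw [hcardo]
      exact Nat.lt_succ_self n
  let p : ℕ → ℕ := Function.extend (fun n => ψ (g (r n))) c fun _ => 0
  have hp : ∀ n, p (ψ (g (r n))) = c n := fun n => hminj.extend_apply _ _ n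
  refine ⟨g, hg, r, p, fun n => ?_, fun x => ?_, ?_, fun n => ?_⟩
  · exact Nat.le_of_lt_succ (Finset.mem_range.1 (Finset.mem_filter.1 (hr n)).1)
  · by_cases hx : ∃ n, ψ (g (r n)) = x
    · obtain ⟨n, rfl⟩ := hx
      obtain ⟨i, hi, h⟩ := Finset.mem_image.1 (hcmem n)
      rw [hp, ← h]
      have := Finset.mem_range.1 hi
      have := hj2 n
      have := hm n
      exact hR _ _ _ (hm n) (by omega)
    · rw [show p x = 0 from Function.extend_apply' _ _ _ hx]
      exact Nat.zero_le _
  · simp only [hp]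
    exact g.injective.comp hcinj
  · obtain ⟨i, hi, h⟩ := Finset.mem_image.1 (hcmem n)
    rw [hp, ← h]
    have hi' := Finset.mem_range.1 hi
    have h1 := hj2 n
    obtain ⟨h2, h3, -, h4⟩ := hkN (j n + 1)
    exact (hfle n _ h1.le).trans (h3.trans (h4 i (by omega)))

/-- A closed permutation group of `ℕ` whose pointwise stabilizers of finite sets all have an
infinite orbit generates, together with finitely many maps, the monoid of all self-maps. -/
theorem exists_finite_closure_eq_top (hc : IsLimitClosed H)
    (hinf : ∀ X : Finset ℕ, ∃ α : ℕ, (MulAction.orbit (fixer H X) α).Infinite) :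
    ∃ U : Set (Function.End ℕ), U.Finite ∧
      Submonoid.closure ((H.toSubmonoid.map (permToEnd ℕ) : Set (Function.End ℕ)) ∪ U) = ⊤ := by
  obtain ⟨R, ψ, hR, hdom⟩ := exists_injective_factor_ge hc hinf
  obtain ⟨a, b, hab⟩ : ∃ a b : Function.End ℕ, ∀ r : ℕ → ℕ, (∀ n, r n ≤ R n) →
      ∃ g ∈ H, ∀ n, b (g (a n)) = r n := exists_factor_of_bounded hc hinf R
  let ψ' : Function.End ℕ := ψ
  let U : Set (Function.End ℕ) := {a, b, ψ'}
  refine ⟨U, Set.toFinite ({a, b, ψ'} : Set (Function.End ℕ)), (Submonoid.eq_top_iff' _).2 fun f => ?_⟩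
  set M := Submonoid.closure ((H.toSubmonoid.map (permToEnd ℕ) : Set (Function.End ℕ)) ∪ U)
  have hU : ∀ u ∈ U, u ∈ M := fun u hu => Submonoid.subset_closure (Or.inr hu)
  have hH : ∀ g ∈ H, permToEnd ℕ g ∈ M := fun g hg =>
    Submonoid.subset_closure (Or.inl ⟨g, hg, rfl⟩)
  have hbdd : ∀ r : Function.End ℕ, (∀ n, r n ≤ R n) → r ∈ M := fun r hr => by
    obtain ⟨g, hg, h⟩ := hab r hr
    have : r = b * permToEnd ℕ g * a :=
      funext fun n => (h n).symm
    rw [this]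
    exact M.mul_mem (M.mul_mem (hU _ (by simp [U])) (hH g hg)) (hU _ (by simp [U]))
  obtain ⟨g, hg, r, p, hr, hp, hinj, hle⟩ := hdom f
  let q : Function.End ℕ := Function.extend (fun n => g (p (ψ (g (r n))))) f fun _ => 0
  have hq : ∀ n, q (g (p (ψ (g (r n))))) = f n := fun n => hinj.extend_apply _ _ n
  have hqR : ∀ x, q x ≤ R x := fun x => by
    by_cases hx : ∃ n, g (p (ψ (g (r n)))) = x
    · obtain ⟨n, rfl⟩ := hx
      rw [hq]
      exact (hle n).trans (hR _)
    · rw [show q x = 0 from Function.extend_apply' _ _ _ hx]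
      exact Nat.zero_le _
  let p' : Function.End ℕ := p
  let r' : Function.End ℕ := r
  have : f = q * permToEnd ℕ g * p' * ψ' * permToEnd ℕ g * r' := funext fun n => (hq n).symm
  rw [this]
  exact M.mul_mem (M.mul_mem (M.mul_mem (M.mul_mem (M.mul_mem (hbdd q hqR) (hH g hg))
    (hbdd p' hp)) (hU _ (by simp [U]))) (hH g hg)) (hbdd r' hr)

/-! ### The closures of a permutation group -/

variable {Ω : Type*}

theorem mem_closureSelf {G : Subgroup (Equiv.Perm Ω)} {f : Function.End Ω} :
    f ∈ closureSelf G ↔ ∀ X : Finset Ω, ∃ g ∈ G, ∀ x ∈ X, g x = f x := by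
  let _ : TopologicalSpace Ω := ⊥
  have : DiscreteTopology Ω := ⟨rfl⟩
  change f ∈ closure ((G.toSubmonoid.map (permToEnd Ω) : Set (Function.End Ω))) ↔ _
  rw [mem_closure_iff]
  constructor
  · intro h X
    obtain ⟨_, ho, g, hg, rfl⟩ := h ((X : Set Ω).pi fun x => {f x})
      (isOpen_set_pi X.finite_toSet fun x _ => isOpen_discrete _) fun x _ => rfl
    exact ⟨g, hg, fun x hx => ho x hx⟩
  · intro h o ho hf
    obtain ⟨X, u, hu, hsub⟩ := isOpen_pi_iff.1 ho f hf
    obtain ⟨g, hg, hgf⟩ := h X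
    refine ⟨permToEnd Ω g, hsub fun x hx => ?_, g, hg, rfl⟩
    change g x ∈ u x
    rw [hgf x hx]
    exact (hu x hx).2

/-- The closure of `G` in the group of permutations, as a subgroup. -/
def limitClosure (G : Subgroup (Equiv.Perm Ω)) : Subgroup (Equiv.Perm Ω) where
  carrier := {p | ∀ X : Finset Ω, ∃ g ∈ G, ∀ x ∈ X, g x = p x}
  one_mem' := fun _ => ⟨1, G.one_mem, fun _ _ => rfl⟩
  mul_mem' := fun {p q} hp hq X => by
    classical
    obtain ⟨h, hh, hhq⟩ := hq X
    obtain ⟨g, hg, hgp⟩ := hp (X.image q)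
    refine ⟨g * h, G.mul_mem hg hh, fun x hx => ?_⟩
    rw [Equiv.Perm.mul_apply, Equiv.Perm.mul_apply, hhq x hx,
      hgp _ (Finset.mem_image_of_mem _ hx)]
  inv_mem' := fun {p} hp X => by
    classical
    obtain ⟨g, hg, hgp⟩ := hp (X.image p.symm)
    refine ⟨g⁻¹, G.inv_mem hg, fun x hx => ?_⟩
    have h := hgp _ (Finset.mem_image_of_mem _ hx)
    rw [Equiv.apply_symm_apply] at h
    exact Equiv.Perm.inv_eq_iff_eq.2 h.symm

theorem mem_limitClosure {G : Subgroup (Equiv.Perm Ω)} {p : Equiv.Perm Ω} :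
    p ∈ limitClosure G ↔ ∀ X : Finset Ω, ∃ g ∈ G, ∀ x ∈ X, g x = p x := Iff.rfl

theorem le_limitClosure (G : Subgroup (Equiv.Perm Ω)) : G ≤ limitClosure G :=
  fun g hg _ => ⟨g, hg, fun _ _ => rfl⟩

theorem isLimitClosed_limitClosure (G : Subgroup (Equiv.Perm Ω)) :
    IsLimitClosed (limitClosure G) := fun p hp X => by
  obtain ⟨h, hh, hhp⟩ := hp X
  obtain ⟨g, hg, hgh⟩ := hh X
  exact ⟨g, hg, fun x hx => (hgh x hx).trans (hhp x hx)⟩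

theorem closureSym_eq_map_limitClosure (G : Subgroup (Equiv.Perm Ω)) :
    closureSym G = (limitClosure G).toSubmonoid.map (permToEnd Ω) := by
  rw [closureSym_eq]
  ext f
  constructor
  · rintro ⟨hf, σ, rfl⟩
    exact ⟨σ, mem_closureSelf.1 hf, rfl⟩
  · rintro ⟨σ, hσ, rfl⟩
    exact ⟨mem_closureSelf.2 hσ, σ, rfl⟩

/-- If all orbits of the pointwise stabilizer of some finite set `X` are finite, then every
`f` in the closure of `G` in `Self(Ω)` is a permutation: up to a factor from `G` it fixes
`X`, hence maps each of these finite orbits injectively into itself. -/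
theorem closureSelf_le_closureSym {G : Subgroup (Equiv.Perm Ω)} {X : Finset Ω}
    (hX : ∀ α : Ω, (MulAction.orbit (fixer (limitClosure G) X) α).Finite) :
    closureSelf G ≤ closureSym G := by
  classical
  intro f hf
  rw [closureSym_eq]
  refine ⟨hf, ?_⟩
  rw [mem_closureSelf] at hf
  obtain ⟨g, hg, hgf⟩ := hf X
  have hinj : Function.Injective f := fun x y hxy => by
    obtain ⟨h, -, hh⟩ := hf {x, y}
    exact h.injective (by rw [hh x (by simp), hh y (by simp), hxy])
  have hmaps : ∀ α : Ω, ∀ x ∈ MulAction.orbit (fixer (limitClosure G) X) α,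
      g⁻¹ (f x) ∈ MulAction.orbit (fixer (limitClosure G) X) α := fun α x hx => by
    obtain ⟨h, hh, hhf⟩ := hf (insert x X)
    have hmem : g⁻¹ * h ∈ fixer (limitClosure G) X := mem_fixer.2
      ⟨le_limitClosure G (G.mul_mem (G.inv_mem hg) hh), fun y hy => by
        rw [Equiv.Perm.mul_apply, hhf y (Finset.mem_insert_of_mem hy), ← hgf y hy]
        simp⟩
    rw [← MulAction.orbit_eq_iff.2 hx]
    refine mem_orbit_fixer.2 ⟨_, hmem, ?_⟩
    rw [Equiv.Perm.mul_apply, hhf x (Finset.mem_insert_self _ _)]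
  have hsurj : Function.Surjective f := fun y => by
    obtain ⟨x, -, hx⟩ := (((hX (g⁻¹ y)).injOn_iff_bijOn_of_mapsTo (hmaps (g⁻¹ y))).1
      (g⁻¹.injective.comp hinj).injOn).surjOn (MulAction.mem_orbit_self (g⁻¹ y))
    exact ⟨x, g⁻¹.injective hx⟩
  exact ⟨Equiv.ofBijective f ⟨hinj, hsurj⟩, rfl⟩

/-- Conjugation by `e : Ω ≃ Ω'` as an isomorphism of monoids of self-maps. -/
def endCongr {Ω' : Type*} (e : Ω ≃ Ω') : Function.End Ω ≃* Function.End Ω' where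
  toFun f := fun x => e (f (e.symm x))
  invFun f := fun x => e.symm (f (e x))
  left_inv f := funext fun x => by simp
  right_inv f := funext fun x => by simp
  map_mul' f g := funext fun x => congrArg (fun y => e (f y)) (e.symm_apply_apply _).symm

/-- Transport of `exists_finite_closure_eq_top` to a countably infinite set. -/
theorem exists_finite_closure_map_eq_top [Countable Ω] [Infinite Ω] {H : Subgroup (Equiv.Perm Ω)}
    (hc : IsLimitClosed H)
    (hinf : ∀ X : Finset Ω, ∃ α : Ω, (MulAction.orbit (fixer H X) α).Infinite) :
    ∃ U : Set (Function.End Ω), U.Finite ∧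
      Submonoid.closure ((H.toSubmonoid.map (permToEnd Ω) : Set (Function.End Ω)) ∪ U) = ⊤ := by
  classical
  obtain ⟨e⟩ : Nonempty (ℕ ≃ Ω) := nonempty_equiv_of_countable
  let H' : Subgroup (Equiv.Perm ℕ) := H.comap e.permCongrHom.toMonoidHom
  have hmem : ∀ p, p ∈ H' ↔ e.permCongr p ∈ H := fun p => Iff.rfl
  have hc' : IsLimitClosed H' := fun p hp => hc _ fun X => by
    obtain ⟨h, hh, hhp⟩ := hp (X.image e.symm)
    refine ⟨e.permCongr h, hh, fun x hx => ?_⟩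
    have := hhp _ (Finset.mem_image_of_mem _ hx)
    simpa using this
  obtain ⟨U, hU, hUtop⟩ := exists_finite_closure_eq_top hc' fun X => by
    obtain ⟨α, hα⟩ := hinf (X.image e)
    refine ⟨e.symm α, (hα.image e.symm.injective.injOn).mono ?_⟩
    rintro _ ⟨y, hy, rfl⟩
    obtain ⟨h, hh, rfl⟩ := mem_orbit_fixer.1 hy
    refine mem_orbit_fixer.2 ⟨e.symm.permCongr h, mem_fixer.2 ⟨?_, fun x hx => ?_⟩, by simp⟩
    · rw [hmem, ← Equiv.permCongr_symm, Equiv.apply_symm_apply]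
      exact (mem_fixer.1 hh).1
    · have := (mem_fixer.1 hh).2 (e x) (Finset.mem_coe.2 (Finset.mem_image_of_mem e hx))
      simp [this]
  refine ⟨endCongr e '' U, hU.image _, top_le_iff.1 ?_⟩
  calc (⊤ : Submonoid (Function.End Ω)) = (⊤ : Submonoid (Function.End ℕ)).map
        (endCongr e).toMonoidHom :=
        (Submonoid.map_equiv_top (endCongr e)).symm
    _ ≤ _ := by
      rw [← hUtop, MonoidHom.map_mclosure, Set.image_union]
      refine Submonoid.closure_mono (Set.union_subset_union_left _ ?_)
      rintro _ ⟨_, ⟨h, hh, rfl⟩, rfl⟩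
      exact ⟨e.permCongr h, hh, rfl⟩

end SelfMap

theorem proposition10p1 (Ω : Type*) [Countable Ω] [Infinite Ω] (G : Subgroup (Equiv.Perm Ω)) :
    SelfMap.Approx (SelfMap.closureSym G) (SelfMap.closureSelf G) := by
  refine ⟨⟨∅, Set.finite_empty, ?_⟩, ?_⟩
  · rw [Set.union_empty, Submonoid.closure_eq, SelfMap.closureSym_eq]
    exact inf_le_left
  · by_cases h : ∃ X : Finset Ω, ∀ α : Ω,
        (MulAction.orbit (SelfMap.fixer (SelfMap.limitClosure G) X) α).Finite
    · obtain ⟨X, hX⟩ := h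
      refine ⟨∅, Set.finite_empty, ?_⟩
      rw [Set.union_empty, Submonoid.closure_eq]
      exact SelfMap.closureSelf_le_closureSym hX
    · push Not at h
      obtain ⟨U, hU, htop⟩ := SelfMap.exists_finite_closure_map_eq_top
        (SelfMap.isLimitClosed_limitClosure G) h
      refine ⟨U, hU, ?_⟩
      rw [SelfMap.closureSym_eq_map_limitClosure, htop]
      exact le_top
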